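/- Let $G$ be a group. Let $X$ be the set of all left cosets $gK$ with $g\in G$ and $K\le G$ a subgroup of finite index; $G$ acts on $X$ by left multiplication. For a union $Y\subseteq X$ of finitely many $G$-orbits let $G_Y\trianglelefteq G$ be the pointwise stabilizer of $Y$ and $G(Y)=G/G_Y$. For $i\in\mathbb N$ let $\rho_{com}(i)$ be the largest $n$ such that $n\le|\{(x,y)\in L\times L: xy=yx\}|$ for every subgroup $L$ of order $i$ of any such $G(Y)$, and $\rho_{com}(i)=\infty$ if no $G(Y)$ has a subgroup of order $i$. Let $\overline G$ denote the profinite completion of $G$. A group is called abelian-by-finite if it has an abelian normal subgroup of finite index, and finite-by-abelian-by-finite if it has normal subgroups $K\le N$ with $K$ finite, $N/K$ abelian and $N$ of finite index. (1) For every real $\varepsilon$ with $0<\varepsilon<1$ there is a number $b=b(\varepsilon)$ such that the following holds for every residually finite group $G$. If $\rho_{com}(|L|)\ge\varepsilon|L|^2$ for every finite quotient $L$ of $G$, then $G$ and $\overline G$ are both abelian-by-finite, and there is an open normal subgroup $N$ of $\overline G$, nilpotent of class at most two, such that $|[N,N]|\le b$ and $|\overline G/N|\le b$. (2) If $G$ is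 a residually finite group which is finite-by-abelian-by-finite, then $G$ and $\overline G$ are both abelian-by-finite. -/

import Mathlib

open scoped Pointwise ENNReal

namespace CommutingPairs

variable {G : Type*} [Group G]

/-- The set `X` of all left cosets `gK`, where `g ∈ G` and `K` is a subgroup of `G` commensurable
with `H`.  For `H = ⊤` these are the cosets of the subgroups of finite index.  The group `G` acts
on subsets of `G` by left translation, and `X` is invariant. -/
def cosetFamily (H : Subgroup G) : Set (Set G) :=
  {s | ∃ (g : G) (K : Subgroup G), Subgroup.Commensurable K H ∧ s = g • (K : Set G)}

/-- The union `Y` of the `G`-orbits of the members of a finite family `F` of subsets of `G`. -/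
def orbitUnion (F : Finset (Set G)) : Set (Set G) :=
  ⋃ s ∈ F, MulAction.orbit G s

/-- The pointwise stabilizer `G_Y` of `Y = orbitUnion F` in `G`. -/
def pointwiseStabilizer (F : Finset (Set G)) : Subgroup G :=
  fixingSubgroup G (orbitUnion F)

theorem smul_mem_orbitUnion (F : Finset (Set G)) (g : G) {s : Set G} (hs : s ∈ orbitUnion F) :
    g • s ∈ orbitUnion F := by
  simp only [orbitUnion, Set.mem_iUnion] at hs ⊢
  obtain ⟨t, ht, hst⟩ := hs
  exact ⟨t, ht, MulAction.mem_orbit_of_mem_orbit g hst⟩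

instance pointwiseStabilizer_normal (F : Finset (Set G)) : (pointwiseStabilizer F).Normal where
  conj_mem n hn g := by
    rw [pointwiseStabilizer, mem_fixingSubgroup_iff] at hn ⊢
    intro s hs
    rw [mul_smul, mul_smul, hn _ (smul_mem_orbitUnion F g⁻¹ hs), smul_inv_smul]

/-- The function `ρ_com` of `G` with respect to `H`: the largest `n` such that
`n ≤ |{(x, y) ∈ L × L : xy = yx}|` for every subgroup `L` of order `i` of a group
`G(Y) = G / G_Y`, where `Y ⊆ X` consists of finitely many `G`-orbits; it is `∞` (the infimum of
the empty family) if no `G(Y)` has a subgroup of order `i`. -/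
noncomputable def rhoCom (H : Subgroup G) (i : ℕ) : ℕ∞ :=
  ⨅ (F : Finset (Set G)) (_ : (F : Set (Set G)) ⊆ cosetFamily H)
    (L : Subgroup (G ⧸ pointwiseStabilizer F)) (_ : Finite L) (_ : Nat.card L = i),
    (Nat.card {p : L × L // p.1 * p.2 = p.2 * p.1} : ℕ∞)

/-- `G` has an abelian normal subgroup of finite index. -/
def IsAbelianByFinite (G : Type*) [Group G] : Prop :=
  ∃ A : Subgroup G, A.Normal ∧ A.FiniteIndex ∧ ∀ x ∈ A, ∀ y ∈ A, x * y = y * x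

/-- `G` has normal subgroups `K ≤ N` such that `K` is finite, `N / K` is abelian and `N` has
finite index in `G`. -/
def IsFiniteByAbelianByFinite (G : Type*) [Group G] : Prop :=
  ∃ K N : Subgroup G, K.Normal ∧ N.Normal ∧ K ≤ N ∧ Finite K ∧ N.FiniteIndex ∧
    ⁅N, N⁆ ≤ K

/-- The profinite completion of `G` (the inverse limit of its finite quotients). -/
noncomputable abbrev Completion (G : Type*) [Group G] : ProfiniteGrp :=
  ProfiniteGrp.ProfiniteCompletion.completion (GrpCat.of G)

end CommutingPairs

/-! A finite group in which a fixed proportion of pairs commutes has many elements with few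
conjugates (`card_le_mul_ncard_smallClasses`). They generate a subgroup of bounded index in
boundedly many steps, so all its elements have boundedly many conjugates. In
`IsResidualFamily.exists_bounded_classes` the preimages of these subgroups stabilize, which carries
the bound over to a profinite group `P`: there is an open normal `H` of bounded index whose elements
have boundedly many conjugates in `P`.

By B. H. Neumann's argument (`encard_commutatorSet_le`, `card_commutator_le`), `[H, H]` is finite of
bounded order. Intersecting `H` with the centralizer of `[H, H]` gives the required `N` of class at
most two.

The hypothesis on `rhoCom` controls every finite quotient of `G`, because each is some `G(Y)`; the
quotients of the completion by open normal subgroups are among these. Finally, residual finiteness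
lets a subgroup of finite index avoid the nontrivial elements of a finite derived subgroup, which
turns finite-by-abelian-by-finite into abelian-by-finite. -/

namespace CommutingPairs

/-! ### Bounded conjugacy classes and Neumann's bound on the derived subgroup. -/

section ConjugacyClasses

variable {G : Type*} [Group G]

theorem encard_mul_le (s t : Set G) : (s * t).encard ≤ s.encard * t.encard := by
  rw [← Set.image_mul_prod, ← Set.encard_prod]
  exact Set.encard_image_le _ _

theorem mem_conjugatesOf_iff {x y : G} : y ∈ conjugatesOf x ↔ ∃ g : G, g * x * g⁻¹ = y :=
  isConj_iff

theorem conjugatesOf_mul_subset (x y : G) :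
    conjugatesOf (x * y) ⊆ conjugatesOf x * conjugatesOf y := by
  intro z hz
  obtain ⟨g, rfl⟩ := mem_conjugatesOf_iff.1 hz
  exact ⟨_, mem_conjugatesOf_iff.2 ⟨g, rfl⟩, _,
    mem_conjugatesOf_iff.2 ⟨g, rfl⟩, by group⟩

theorem conj_mem_conjugatesOf (g x : G) : g * x * g⁻¹ ∈ conjugatesOf x :=
  mem_conjugatesOf_iff.2 ⟨g, rfl⟩

theorem conjugatesOf_inv (x : G) : conjugatesOf x⁻¹ = (conjugatesOf x)⁻¹ := by
  ext z
  simp only [Set.mem_inv, mem_conjugatesOf_iff]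
  refine exists_congr fun g ↦ ?_
  rw [← inv_inj (a := g * x⁻¹ * g⁻¹)]
  simp [mul_assoc]

theorem conjugatesOf_one : conjugatesOf (1 : G) = {1} := by
  ext z
  simp [mem_conjugatesOf_iff, eq_comm]

theorem image_conjugatesOf {G' : Type*} [Group G'] {f : G →* G'} (hf : Function.Surjective f)
    (x : G) : f '' conjugatesOf x = conjugatesOf (f x) := by
  ext z
  constructor
  · rintro ⟨y, hy, rfl⟩
    obtain ⟨g, rfl⟩ := mem_conjugatesOf_iff.1 hy
    simpa using conj_mem_conjugatesOf (f g) (f x)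
  · intro hz
    obtain ⟨g, rfl⟩ := mem_conjugatesOf_iff.1 hz
    obtain ⟨g, rfl⟩ := hf g
    exact ⟨_, conj_mem_conjugatesOf g x, by simp⟩

/-- The index of the centralizer of `x` is the size of the conjugacy class of `x`. -/
theorem index_centralizer_singleton (x : G) :
    (Subgroup.centralizer {x}).index = (conjugatesOf x).ncard := by
  rw [Subgroup.centralizer_eq_comap_stabilizer]
  have h1 := Subgroup.index_comap_of_surjective (MulAction.stabilizer (ConjAct G) x)
    (f := (ConjAct.toConjAct : G ≃* ConjAct G).toMonoidHom) ConjAct.toConjAct.surjective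
  refine h1.trans ?_
  rw [MulAction.index_stabilizer, ConjAct.orbit_eq_carrier_conjClasses]
  rfl

/-- The centralizer of a set of at most `m` elements with at most `n` conjugates each. -/
theorem index_centralizer_le {n m : ℕ} (hpos : 0 < n) (Y : Set G) (hY : Y.encard ≤ m)
    (h : ∀ y ∈ Y, (conjugatesOf y).encard ≤ n) :
    (Subgroup.centralizer Y).FiniteIndex ∧ (Subgroup.centralizer Y).index ≤ n ^ m := by
  obtain ⟨hfin, hcard⟩ := Set.encard_le_coe_iff_finite_ncard_le.1 hY
  have key : Subgroup.centralizer Y = ⨅ y : Y, Subgroup.centralizer {(y : G)} := by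
    ext g
    simp [Subgroup.mem_centralizer_iff, Subgroup.mem_iInf]
  have hn (y : Y) : (Subgroup.centralizer {(y : G)}).index ≤ n := by
    rw [index_centralizer_singleton]
    exact (Set.encard_le_coe_iff_finite_ncard_le.1 (h y y.2)).2
  have hne (y : Y) : (Subgroup.centralizer {(y : G)}).index ≠ 0 := by
    rw [index_centralizer_singleton]
    have := (Set.encard_le_coe_iff_finite_ncard_le.1 (h y y.2)).1
    exact ((Set.ncard_pos this).2 ⟨_, mem_conjugatesOf_self⟩).ne'
  have : Fintype Y := hfin.fintype
  refine ⟨⟨?_⟩, ?_⟩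
  · rw [key]
    exact Subgroup.index_iInf_ne_zero hne
  · rw [key]
    refine (Subgroup.index_iInf_le _).trans ?_
    refine (Finset.prod_le_prod' fun y _ ↦ hn y).trans ?_
    rw [Finset.prod_const, Finset.card_univ, ← Nat.card_eq_fintype_card, Nat.card_coe_set_eq]
    exact Nat.pow_le_pow_right hpos hcard

/-- In a group whose conjugacy classes have at most `n` elements there are at most
`n ^ (n + 3)` commutators. -/
theorem encard_commutatorSet_le {n : ℕ} (h : ∀ x : G, (conjugatesOf x).encard ≤ n) :
    (commutatorSet G).encard ≤ (n ^ (n + 3) : ℕ) := by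
  have hfin (x : G) := (Set.encard_le_coe_iff_finite_ncard_le.1 (h x)).1
  have hcard (x : G) := (Set.encard_le_coe_iff_finite_ncard_le.1 (h x)).2
  have hpos : 0 < n := ((Set.ncard_pos (hfin 1)).2 ⟨1, mem_conjugatesOf_self⟩).trans_le (hcard 1)
  obtain ⟨x, hx⟩ : ∃ x : G, ∀ y : G, (conjugatesOf y).ncard ≤ (conjugatesOf x).ncard := by
    have hb : BddAbove (Set.range fun y : G ↦ (conjugatesOf y).ncard) :=
      ⟨n, by rintro _ ⟨y, rfl⟩; exact hcard y⟩
    obtain ⟨x, hx⟩ := Nat.sSup_mem (Set.range_nonempty _) hb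
    exact ⟨x, fun y ↦ (le_csSup hb ⟨y, rfl⟩).trans_eq hx.symm⟩
  -- A conjugator `y z` for each `z` in the largest class; the value 1 off the class is never used.
  have hy : ∀ z : G, ∃ y : G, z ∈ conjugatesOf x → y * x * y⁻¹ = z := by
    intro z
    by_cases hz : z ∈ conjugatesOf x
    · obtain ⟨g, hg⟩ := mem_conjugatesOf_iff.1 hz
      exact ⟨g, fun _ ↦ hg⟩
    · exact ⟨1, fun h ↦ absurd h hz⟩
  choose y hy using hy
  set C := Subgroup.centralizer (y '' conjugatesOf x) with hC
  obtain ⟨hCf, hCi⟩ := index_centralizer_le (n := n) (m := n) hpos (y '' conjugatesOf x)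
    ((Set.encard_image_le _ _).trans (h x)) (fun _ _ ↦ h _)
  -- Since `u` commutes with the conjugators, translation by `u` sends the class of `x` into that of
  -- `x * u`; maximality of the former forces equality.
  have hclass (u : G) (hu : u ∈ C) :
      conjugatesOf (x * u) = (fun z ↦ z * u) '' conjugatesOf x := by
    symm
    refine Set.eq_of_subset_of_ncard_le ?_ ?_ (hfin _)
    · rintro _ ⟨z, hz, rfl⟩
      have h1 : y z * u = u * y z := (Subgroup.mem_centralizer_iff.1 hu) _ ⟨z, hz, rfl⟩
      have h2 : y z * (x * u) * (y z)⁻¹ = z * u := by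
        calc y z * (x * u) * (y z)⁻¹ = y z * x * (y z)⁻¹ * (y z * u * (y z)⁻¹) := by group
          _ = z * u := by rw [hy z hz, h1, mul_inv_cancel_right]
      exact mem_conjugatesOf_iff.2 ⟨y z, h2⟩
    · rw [Set.ncard_image_of_injective _ (mul_left_injective u)]
      exact hx _
  set D : Set G := (conjugatesOf x)⁻¹ * conjugatesOf x with hD
  have hDcard : D.encard ≤ (n * n : ℕ) := by
    refine (encard_mul_le _ _).trans ?_
    rw [Set.encard_inv, Nat.cast_mul]
    exact mul_le_mul' (h x) (h x)
  have hmem (g u : G) (hu : u ∈ C) : g * u * g⁻¹ * u⁻¹ ∈ D := by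
    have h1 := conj_mem_conjugatesOf g (x * u)
    rw [hclass u hu] at h1
    obtain ⟨z, hz, h2⟩ := h1
    refine ⟨(g * x * g⁻¹)⁻¹, Set.inv_mem_inv.2 (conj_mem_conjugatesOf g x), z, hz, ?_⟩
    have h3 : z = g * (x * u) * g⁻¹ * u⁻¹ := eq_mul_inv_of_mul_eq h2
    rw [h3]
    group
  have : Fintype (G ⧸ C) := Fintype.ofFinite _
  -- For `w = t * v` with `t` a coset representative and `v ∈ C`, `[g, w] = [g, t] * t [g, v] t⁻¹`.
  -- There are at most `n` choices for the first factor and `n ^ 2` for the second, over at most `n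
  -- ^ n` cosets.
  have hsub : commutatorSet G ⊆ ⋃ q ∈ (Finset.univ : Finset (G ⧸ C)),
      (conjugatesOf q.out * {q.out⁻¹}) * ((fun d ↦ q.out * d * q.out⁻¹) '' D) := by
    rintro _ ⟨g, w, rfl⟩
    simp only [Finset.mem_univ, Set.iUnion_true, Set.mem_iUnion]
    refine ⟨(w : G ⧸ C), ?_⟩
    obtain ⟨u, hu⟩ := QuotientGroup.mk_out_eq_mul C w
    set t := (w : G ⧸ C).out
    have hw : w = t * (u : G)⁻¹ := by rw [hu]; group
    refine ⟨g * t * g⁻¹ * t⁻¹, ⟨_, conj_mem_conjugatesOf g t, _, rfl, rfl⟩, _,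
      ⟨_, hmem g _ (C.inv_mem u.2), rfl⟩, ?_⟩
    rw [hw, commutatorElement_def]
    group
  refine (Set.encard_le_encard hsub).trans ((Finset.set_encard_biUnion_le _ _).trans ?_)
  have hterm (q : G ⧸ C) : ((conjugatesOf q.out * {q.out⁻¹}) *
      ((fun d ↦ q.out * d * q.out⁻¹) '' D)).encard ≤ (n ^ 3 : ℕ) := by
    refine (encard_mul_le _ _).trans ?_
    refine (mul_le_mul' ((encard_mul_le _ _).trans (mul_le_mul' (h _)
      (Set.encard_singleton _).le)) ((Set.encard_image_le _ _).trans hDcard)).trans ?_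
    rw [mul_one, ← Nat.cast_mul]
    exact_mod_cast (by ring_nf; rfl)
  refine (Finset.sum_le_sum fun q _ ↦ hterm q).trans ?_
  rw [Finset.sum_const, nsmul_eq_mul, Finset.card_univ, ← Nat.card_eq_fintype_card, ← Nat.cast_mul,
    pow_add]
  exact_mod_cast Nat.mul_le_mul_right _ hCi

/-- A bound for the derived subgroup of a group with at most `m` commutators. -/
def derivedBound (m : ℕ) : ℕ := (Finset.range (m + 1)).sup Subgroup.cardCommutatorBound

/-- The derived subgroup of a group whose conjugacy classes have at most `n` elements is finite,
of order bounded in terms of `n`. -/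
theorem card_commutator_le {n : ℕ} (H : Subgroup G)
    (h : ∀ x ∈ H, (conjugatesOf x).encard ≤ n) :
    Finite (⁅H, H⁆ : Subgroup G) ∧
      Nat.card (⁅H, H⁆ : Subgroup G) ≤ derivedBound (n ^ (n + 3)) := by
  have hH (x : H) : (conjugatesOf x).encard ≤ n := by
    refine le_trans ?_ (h x x.2)
    rw [← Set.InjOn.encard_image (f := ((↑) : H → G)) Subtype.coe_injective.injOn]
    refine Set.encard_le_encard ?_
    rintro _ ⟨y, hy, rfl⟩
    obtain ⟨g, rfl⟩ := mem_conjugatesOf_iff.1 hy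
    exact conj_mem_conjugatesOf (g : G) x
  obtain ⟨hf, hc⟩ := Set.encard_le_coe_iff_finite_ncard_le.1 (encard_commutatorSet_le hH)
  have : Finite (commutatorSet H) := hf
  rw [← Subgroup.map_subtype_commutator]
  have e := (commutator H).equivMapOfInjective H.subtype H.subtype_injective
  refine ⟨Finite.of_equiv _ e.toEquiv, ?_⟩
  rw [← Nat.card_congr e.toEquiv]
  refine (Subgroup.card_commutator_le_of_finite_commutatorSet H).trans ?_
  -- The supremum in `derivedBound` makes an upper bound on the number of commutators enough,
  -- without monotonicity of `cardCommutatorBound`.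
  refine Finset.le_sup (f := Subgroup.cardCommutatorBound) ?_
  rw [Finset.mem_range, Nat.lt_succ_iff]
  exact hc

end ConjugacyClasses

/-! ### Growth of powers of a symmetric set. -/

section Growth

variable {Q : Type*} [Group Q]

theorem pow_subset_closure (X : Set Q) (m : ℕ) : X ^ m ⊆ (Subgroup.closure X : Set Q) := by
  induction m with
  | zero => simp
  | succ m ih =>
    rw [pow_succ]
    rintro _ ⟨x, hx, y, hy, rfl⟩
    exact mul_mem (ih hx) (Subgroup.subset_closure hy)

/-- Once a further factor gives nothing new, `X ^ m` is stable under right multiplication by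
generators and their inverses. -/
theorem coe_closure_eq_pow {X : Set Q} (h1 : 1 ∈ X) (hinv : X⁻¹ = X) {m : ℕ}
    (h : X ^ (m + 1) ⊆ X ^ m) : (Subgroup.closure X : Set Q) = X ^ m := by
  refine Set.Subset.antisymm ?_ (pow_subset_closure X m)
  intro q hq
  have hstep : ∀ x ∈ X ^ m, ∀ y ∈ X, x * y ∈ X ^ m := fun x hx y hy ↦
    h (by rw [pow_succ]; exact Set.mul_mem_mul hx hy)
  induction hq using Subgroup.closure_induction_right with
  | one => exact Set.one_mem_pow h1
  | mul_right x _ y hy ih => exact hstep x ih y hy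
  | mul_inv_cancel x _ y hy ih => exact hstep x ih _ (hinv ▸ Set.inv_mem_inv.2 hy)

/-- A symmetric subset of a finite group `Q` with at least `|Q| / c` elements generates its
subgroup in at most `3 * c + 1` steps. -/
theorem coe_closure_eq_pow_of_card_le [Finite Q] {X : Set Q} (h1 : 1 ∈ X) (hinv : X⁻¹ = X) {c : ℕ}
    (hc : Nat.card Q ≤ c * X.ncard) : (Subgroup.closure X : Set Q) = X ^ (3 * c + 1) := by
  have hmono {m k : ℕ} (hmk : m ≤ k) : X ^ m ⊆ X ^ k := Set.pow_subset_pow_right h1 hmk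
  -- Until the powers stabilize, three more factors gain at least `|X|` elements: for `z` in `X ^ (3
  -- * j + 3)` but not in `X ^ (3 * j + 2)`, the translate `z • X` misses `X ^ (3 * j + 1)`. At `j =
  -- c` this would exceed `|Q|`.
  have key : ∀ j : ℕ, (Subgroup.closure X : Set Q) = X ^ (3 * j + 1) ∨
      (j + 1) * X.ncard ≤ (X ^ (3 * j + 1)).ncard := by
    intro j
    induction j with
    | zero => right; simp
    | succ j ih =>
      by_cases hst : X ^ (3 * j + 2 + 1) ⊆ X ^ (3 * j + 2)
      · left
        have h2 := coe_closure_eq_pow h1 hinv hst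
        refine Set.Subset.antisymm ?_ (pow_subset_closure X _)
        rw [h2]
        exact hmono (by omega)
      · rcases ih with ih | ih
        · refine absurd ?_ hst
          refine subset_trans (pow_subset_closure X _) ?_
          rw [ih]
          exact hmono (by omega)
        · right
          obtain ⟨z, hz, hz'⟩ := Set.not_subset.1 hst
          have hdisj : Disjoint (X ^ (3 * j + 1)) (z • X) := by
            rw [Set.disjoint_left]
            rintro _ hx ⟨y, hy, rfl⟩
            refine hz' ?_
            rw [pow_succ]
            refine ⟨_, hx, y⁻¹, hinv ▸ Set.inv_mem_inv.2 hy, ?_⟩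
            simp
          have hsub : X ^ (3 * j + 1) ∪ z • X ⊆ X ^ (3 * (j + 1) + 1) := by
            refine Set.union_subset (hmono (by omega)) ?_
            rintro _ ⟨y, hy, rfl⟩
            rw [pow_succ]
            exact Set.mul_mem_mul hz hy
          calc (j + 1 + 1) * X.ncard = (j + 1) * X.ncard + X.ncard := by ring
            _ ≤ (X ^ (3 * j + 1)).ncard + (z • X).ncard := by
              rw [Set.ncard_smul_set]
              exact Nat.add_le_add_right ih _
            _ = (X ^ (3 * j + 1) ∪ z • X).ncard := (Set.ncard_union_eq hdisj).symm
            _ ≤ _ := Set.ncard_le_ncard hsub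
  refine (key c).resolve_right fun hbad ↦ ?_
  have h3 : (X ^ (3 * c + 1)).ncard ≤ Nat.card Q := Set.ncard_le_card _
  have h4 : 0 < X.ncard := (Set.ncard_pos).2 ⟨1, h1⟩
  nlinarith

theorem index_closure_le [Finite Q] {X : Set Q} (h1 : 1 ∈ X) {c : ℕ}
    (hc : Nat.card Q ≤ c * X.ncard) : (Subgroup.closure X).index ≤ c := by
  have h2 : X.ncard ≤ Nat.card (Subgroup.closure X) := Set.ncard_le_ncard Subgroup.subset_closure
  have h3 := (Subgroup.closure X).card_mul_index
  have h4 : 0 < X.ncard := (Set.ncard_pos).2 ⟨1, h1⟩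
  by_contra hlt
  push Not at hlt
  have h5 : c * X.ncard < (Subgroup.closure X).index * Nat.card (Subgroup.closure X) :=
    Nat.mul_lt_mul_of_lt_of_le hlt h2 (h4.trans_le h2)
  nlinarith

end Growth

/-! ### Elements with few conjugates in a finite group. -/

section SmallClasses

variable {Q : Type*} [Group Q]

/-- The elements with at most `c` conjugates. -/
def smallClasses (Q : Type*) [Group Q] (c : ℕ) : Set Q := {x | (conjugatesOf x).encard ≤ c}

theorem one_mem_smallClasses {c : ℕ} (hc : 0 < c) : (1 : Q) ∈ smallClasses Q c := by
  simp only [smallClasses, Set.mem_ofPred_eq, conjugatesOf_one, Set.encard_singleton]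
  exact_mod_cast hc

theorem inv_smallClasses (c : ℕ) : (smallClasses Q c)⁻¹ = smallClasses Q c := by
  ext x
  simp [smallClasses, conjugatesOf_inv]

theorem map_mem_smallClasses {Q' : Type*} [Group Q'] {f : Q →* Q'} (hf : Function.Surjective f)
    {c : ℕ} {x : Q} (hx : x ∈ smallClasses Q c) : f x ∈ smallClasses Q' c := by
  rw [smallClasses, Set.mem_ofPred_eq, ← image_conjugatesOf hf]
  exact (Set.encard_image_le _ _).trans hx

theorem encard_conjugatesOf_le_of_mem_pow {c k : ℕ} {x : Q} (hx : x ∈ smallClasses Q c ^ k) :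
    (conjugatesOf x).encard ≤ (c ^ k : ℕ) := by
  induction k generalizing x with
  | zero =>
    rw [pow_zero, Set.mem_one] at hx
    simp [hx, conjugatesOf_one]
  | succ k ih =>
    rw [pow_succ] at hx
    obtain ⟨y, hy, z, hz, rfl⟩ := hx
    refine (Set.encard_le_encard (conjugatesOf_mul_subset y z)).trans
      ((encard_mul_le _ _).trans ?_)
    rw [pow_succ, Nat.cast_mul]
    exact mul_le_mul' (ih hy) hz

instance closure_smallClasses_normal (c : ℕ) :
    (Subgroup.closure (smallClasses Q c)).Normal := by
  have : Group.conjugatesOfSet (smallClasses Q c) = smallClasses Q c := by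
    refine Set.Subset.antisymm (fun x hx ↦ ?_) Group.subset_conjugatesOfSet
    obtain ⟨a, ha, hax⟩ := Group.mem_conjugatesOfSet_iff.1 hx
    rw [smallClasses, Set.mem_ofPred_eq, ← hax.conjugatesOf_eq]
    exact ha
  rw [← this]
  exact Subgroup.normalClosure_normal

/-- If at least one in `d` pairs of elements of `Q` commute, then at least one in `2 * d` elements
of `Q` has at most `2 * d` conjugates. -/
theorem card_le_mul_ncard_smallClasses [Finite Q] {d : ℕ}
    (h : Nat.card Q ^ 2 ≤ d * Nat.card {p : Q × Q // p.1 * p.2 = p.2 * p.1}) :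
    Nat.card Q ≤ 2 * d * (smallClasses Q (2 * d)).ncard := by
  classical
  have : Fintype Q := Fintype.ofFinite Q
  have hpairs : Nat.card {p : Q × Q // p.1 * p.2 = p.2 * p.1} =
      ∑ x : Q, Nat.card (Subgroup.centralizer {x}) := by
    rw [← Nat.card_sigma]
    refine Nat.card_congr ⟨fun p ↦ ⟨p.1.1, p.1.2, ?_⟩, fun s ↦ ⟨(s.1, s.2), ?_⟩,
      fun _ ↦ rfl, fun _ ↦ rfl⟩
    · simpa [Subgroup.mem_centralizer_iff] using p.2
    · exact Subgroup.mem_centralizer_iff.1 s.2.2 s.1 rfl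
  have hpos : 0 < Nat.card Q := Nat.card_pos
  have hX : (smallClasses Q (2 * d)).ncard =
      (Finset.univ.filter fun x ↦ x ∈ smallClasses Q (2 * d)).card := by
    rw [← Set.ncard_coe_finset]
    simp
  -- An element outside `smallClasses` has centralizer of order at most `|Q| / (2 * d)`, so such
  -- elements account for at most half of the guaranteed `|Q| ^ 2 / d` commuting pairs.
  have hterm (x : Q) : 2 * d * Nat.card (Subgroup.centralizer {x}) ≤
      (if x ∈ smallClasses Q (2 * d) then 2 * d * Nat.card Q else 0) + Nat.card Q := by
    have h1 := (Subgroup.centralizer {x}).card_mul_index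
    rw [index_centralizer_singleton] at h1
    split_ifs with hx
    · exact (Nat.mul_le_mul_left _ (Subgroup.card_le_card_group _)).trans (Nat.le_add_right _ _)
    · have h2 : 2 * d ≤ (conjugatesOf x).ncard := by
        by_contra hlt
        exact hx (Set.encard_le_coe_iff_finite_ncard_le.2 ⟨Set.toFinite _, by omega⟩)
      rw [zero_add, ← h1, mul_comm]
      exact Nat.mul_le_mul_left _ h2
  have hsum := Finset.sum_le_sum fun x (_ : x ∈ Finset.univ) ↦ hterm x
  rw [← Finset.mul_sum, ← hpairs, Finset.sum_add_distrib, ← Finset.sum_filter, Finset.sum_const,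
    Finset.sum_const, Finset.card_univ, ← Nat.card_eq_fintype_card, ← hX, smul_eq_mul,
    smul_eq_mul] at hsum
  refine Nat.le_of_mul_le_mul_right ?_ hpos
  nlinarith

end SmallClasses

/-! ### From finite quotients to a residually finite group. -/

section ResidualFamily

variable {Γ : Type*} [Group Γ]

/-- A family of normal subgroups of finite index that is closed under intersections and separates
the elements of the group. -/
structure IsResidualFamily (ℱ : Set (FiniteIndexNormalSubgroup Γ)) : Prop where
  nonempty : ℱ.Nonempty
  inf_mem : ∀ U ∈ ℱ, ∀ V ∈ ℱ, U ⊓ V ∈ ℱ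
  separates : ∀ g : Γ, g ≠ 1 → ∃ U ∈ ℱ, g ∉ U

variable {ℱ : Set (FiniteIndexNormalSubgroup Γ)}

theorem IsResidualFamily.exists_forall_notMem (hℱ : IsResidualFamily ℱ) {E : Set Γ}
    (hE : E.Finite) : ∃ U ∈ ℱ, ∀ e ∈ E, e ∈ U → e = 1 := by
  induction E, hE using Set.Finite.induction_on with
  | empty =>
    obtain ⟨U, hU⟩ := hℱ.nonempty
    exact ⟨U, hU, by simp⟩
  | @insert a s _ _ ih =>
    obtain ⟨U, hU, h⟩ := ih
    by_cases ha : a = 1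
    · refine ⟨U, hU, ?_⟩
      rintro e (rfl | he) heU
      · exact ha
      · exact h e he heU
    · obtain ⟨V, hV, haV⟩ := hℱ.separates a ha
      refine ⟨U ⊓ V, hℱ.inf_mem U hU V hV, ?_⟩
      rintro e (rfl | he) heU
      · exact absurd (inf_le_right (a := U) heU) haV
      · exact h e he (inf_le_left (b := V) heU)

/-- Any `n + 1` distinct elements of `S` stay distinct modulo a member of the family that avoids the
finitely many nontrivial `a⁻¹ * b`. -/
theorem IsResidualFamily.encard_le (hℱ : IsResidualFamily ℱ) {S : Set Γ} {n : ℕ}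
    (h : ∀ U ∈ ℱ, (QuotientGroup.mk' U.toSubgroup '' S).encard ≤ n) : S.encard ≤ n := by
  by_contra hlt
  have h1 : ((n + 1 : ℕ) : ℕ∞) ≤ S.encard := by
    push_cast
    exact Order.add_one_le_of_lt (not_le.1 hlt)
  obtain ⟨T, hTS, hT⟩ := Set.exists_subset_encard_eq h1
  have hfin : T.Finite := Set.finite_of_encard_eq_coe hT
  obtain ⟨U, hU, hsep⟩ := hℱ.exists_forall_notMem (hfin.inv.mul hfin)
  have hinj : Set.InjOn (QuotientGroup.mk' U.toSubgroup) T := by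
    intro a ha b hb hab
    have h2 : a⁻¹ * b ∈ U.toSubgroup := QuotientGroup.eq.1 hab
    exact inv_mul_eq_one.1 (hsep _ (Set.mul_mem_mul (Set.inv_mem_inv.2 ha) hb) h2)
  have h3 := (Set.encard_le_encard (Set.image_mono hTS)).trans (h U hU)
  rw [hinj.encard_image, hT] at h3
  have : n + 1 ≤ n := by exact_mod_cast h3
  omega

/-- If in every quotient by a member of a residual family at least one in `d` pairs commute, then
the group has a normal subgroup of bounded index whose elements have boundedly many conjugates. -/
theorem IsResidualFamily.exists_bounded_classes (hℱ : IsResidualFamily ℱ) {d : ℕ} (hd : 0 < d)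
    (h : ∀ U ∈ ℱ, Nat.card (Γ ⧸ U.toSubgroup) ^ 2 ≤
      d * Nat.card {p : (Γ ⧸ U.toSubgroup) × (Γ ⧸ U.toSubgroup) // p.1 * p.2 = p.2 * p.1}) :
    ∃ H : Subgroup Γ, H.Normal ∧ H.FiniteIndex ∧ H.index ≤ 2 * d ∧
      (∃ U ∈ ℱ, U.toSubgroup ≤ H) ∧
      ∀ x ∈ H, (conjugatesOf x).encard ≤ ((2 * d) ^ (3 * (2 * d) + 1) : ℕ) := by
  set c := 2 * d with hc
  have hcpos : 0 < c := by omega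
  let K (U : FiniteIndexNormalSubgroup Γ) : Subgroup Γ :=
    (Subgroup.closure (smallClasses (Γ ⧸ U.toSubgroup) c)).comap (QuotientGroup.mk' U.toSubgroup)
  have hKle (U) : U.toSubgroup ≤ K U := fun x hx ↦ by
    change QuotientGroup.mk' U.toSubgroup x ∈ Subgroup.closure _
    rw [show QuotientGroup.mk' U.toSubgroup x = 1 from (QuotientGroup.eq_one_iff x).2 hx]
    exact one_mem _
  have hfi (U) : (K U).FiniteIndex := Subgroup.finiteIndex_of_le (hKle U)
  have hmono (U V : FiniteIndexNormalSubgroup Γ) (hUV : U ≤ V) : K U ≤ K V := by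
    let f := QuotientGroup.map U.toSubgroup V.toSubgroup (MonoidHom.id Γ) hUV
    have hf : Function.Surjective f := by
      rintro ⟨x⟩
      exact ⟨QuotientGroup.mk x, rfl⟩
    have hcl : Subgroup.closure (smallClasses (Γ ⧸ U.toSubgroup) c) ≤
        (Subgroup.closure (smallClasses (Γ ⧸ V.toSubgroup) c)).comap f :=
      (Subgroup.closure_le _).2 fun x hx ↦
        Subgroup.subset_closure (map_mem_smallClasses hf hx)
    exact fun x hx ↦ hcl hx
  have hcard (U) (hU : U ∈ ℱ) := card_le_mul_ncard_smallClasses (h U hU)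
  have hindex (U) (hU : U ∈ ℱ) : (K U).index ≤ c := by
    rw [Subgroup.index_comap_of_surjective _ (QuotientGroup.mk'_surjective _)]
    exact index_closure_le (one_mem_smallClasses hcpos) (hcard U hU)
  -- `K` shrinks with `U` but its index stays at most `c`, so it is constant below a `U₀` of maximal
  -- index.
  obtain ⟨U₀, hU₀, hmax⟩ : ∃ U₀ ∈ ℱ, ∀ U ∈ ℱ, (K U).index ≤ (K U₀).index := by
    have hb : BddAbove ((fun U ↦ (K U).index) '' ℱ) :=
      ⟨c, by rintro _ ⟨U, hU, rfl⟩; exact hindex U hU⟩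
    obtain ⟨U₀, hU₀, hs⟩ := Nat.sSup_mem (hℱ.nonempty.image _) hb
    exact ⟨U₀, hU₀, fun U hU ↦ (le_csSup hb ⟨U, hU, rfl⟩).trans_eq hs.symm⟩
  refine ⟨K U₀, inferInstance, hfi U₀, hindex U₀ hU₀, ⟨U₀, hU₀, hKle U₀⟩, fun x hx ↦ ?_⟩
  refine hℱ.encard_le fun U hU ↦ ?_
  -- Modulo `W`, where `K W = K U₀`, the image of `x` is a product of `3 * c + 1` elements with at
  -- most `c` conjugates; the bound then descends to the quotient by `U`.
  set W := U ⊓ U₀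
  have hW : W ∈ ℱ := hℱ.inf_mem U hU U₀ hU₀
  have hKW : K W ≤ K U₀ := hmono W U₀ inf_le_right
  have heq : K U₀ ≤ K W := by
    have h1 := Subgroup.relIndex_mul_index hKW
    have h2 := hmax W hW
    have h3 : 0 < (K U₀).index := Nat.pos_of_ne_zero (hfi U₀).index_ne_zero
    have h4 : 0 < (K W).index := Nat.pos_of_ne_zero (hfi W).index_ne_zero
    rw [← Subgroup.relIndex_eq_one]
    nlinarith
  have hxW : QuotientGroup.mk' W.toSubgroup x ∈
      (Subgroup.closure (smallClasses (Γ ⧸ W.toSubgroup) c) : Set (Γ ⧸ W.toSubgroup)) := heq hx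
  rw [coe_closure_eq_pow_of_card_le (one_mem_smallClasses hcpos) (inv_smallClasses c)
    (hcard W hW)] at hxW
  have hbound := encard_conjugatesOf_le_of_mem_pow hxW
  rw [← image_conjugatesOf (QuotientGroup.mk'_surjective _)] at hbound
  refine le_trans ?_ hbound
  let f := QuotientGroup.map W.toSubgroup U.toSubgroup (MonoidHom.id Γ) (inf_le_left (a := U))
  have hcomp : QuotientGroup.mk' U.toSubgroup '' conjugatesOf x =
      f '' (QuotientGroup.mk' W.toSubgroup '' conjugatesOf x) := by
    rw [Set.image_image]
    rfl
  rw [hcomp]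
  exact Set.encard_image_le _ _

end ResidualFamily

/-! ### Abelian-by-finite groups. -/

section AbelianByFinite

variable {G P : Type*} [Group G] [Group P]

theorem IsAbelianByFinite.of_finiteIndex (A : Subgroup G) [A.FiniteIndex]
    (h : ∀ x ∈ A, ∀ y ∈ A, x * y = y * x) : IsAbelianByFinite G :=
  ⟨A.normalCore, inferInstance, inferInstance,
    fun x hx y hy ↦ h x (A.normalCore_le hx) y (A.normalCore_le hy)⟩

theorem IsAbelianByFinite.of_injective {f : G →* P} (hf : Function.Injective f)
    (h : IsAbelianByFinite P) : IsAbelianByFinite G := by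
  obtain ⟨A, hA, hfi, hcomm⟩ := h
  refine ⟨A.comap f, inferInstance, ⟨?_⟩, fun x hx y hy ↦ hf ?_⟩
  · rw [Subgroup.index_comap]
    exact fun h0 ↦ hfi.index_ne_zero (Nat.eq_zero_of_zero_dvd
      (h0 ▸ Subgroup.relIndex_dvd_index_of_normal A f.range))
  · rw [map_mul, map_mul]
    exact hcomm _ hx _ hy

/-- Choose a normal `M` of finite index with `K ∩ M = 1`; commutators of elements of `N ∩ M` lie in
`K ∩ M`. -/
theorem IsFiniteByAbelianByFinite.isAbelianByFinite [Group.ResiduallyFinite G]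
    (h : IsFiniteByAbelianByFinite G) : IsAbelianByFinite G := by
  obtain ⟨K, N, -, hN, -, hK, hfi, hcomm⟩ := h
  have hℱ : IsResidualFamily (Set.univ : Set (FiniteIndexNormalSubgroup G)) :=
    { nonempty := ⟨FiniteIndexNormalSubgroup.ofSubgroup ⊤, trivial⟩
      inf_mem := fun _ _ _ _ ↦ trivial
      separates := fun g hg ↦
        (Group.exists_finiteIndexNormalSubgroup_notMem g hg).imp fun _ h ↦ ⟨trivial, h⟩ }
  obtain ⟨M, -, hM⟩ := hℱ.exists_forall_notMem (E := (K : Set G)) (Set.toFinite _)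
  refine ⟨N ⊓ M.toSubgroup, inferInstance, inferInstance, fun x hx y hy ↦ ?_⟩
  rw [← commutatorElement_eq_one_iff_mul_comm]
  refine hM _ (hcomm (Subgroup.commutator_mem_commutator hx.1 hy.1)) ?_
  exact Subgroup.commutator_le_left M.toSubgroup M.toSubgroup
    (Subgroup.commutator_mem_commutator hx.2 hy.2)

/-- A Hausdorff group with a dense abelian-by-finite subgroup is abelian-by-finite. -/
theorem IsAbelianByFinite.of_denseRange [TopologicalSpace P] [IsTopologicalGroup P] [T2Space P]
    {f : G →* P} (hf : DenseRange f) (h : IsAbelianByFinite G) : IsAbelianByFinite P := by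
  obtain ⟨A, hA, hfi, hcomm⟩ := h
  set B := (A.map f).topologicalClosure with hB
  have hBclosed : IsClosed (B : Set P) := Subgroup.isClosed_topologicalClosure _
  have hle : A.map f ≤ B := Subgroup.le_topologicalClosure _
  -- A finite union of closed translates of `B` that contains the dense image of `f` is everything,
  -- so `B` has finite index.
  have hcover : ⋃ q : G ⧸ A, f q.out • (B : Set P) = Set.univ := by
    refine Set.eq_univ_of_univ_subset ?_
    rw [← hf.closure_range]
    refine closure_minimal ?_ (isClosed_iUnion_of_finite fun q ↦ hBclosed.smul _)
    rintro _ ⟨g, rfl⟩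
    obtain ⟨a, ha⟩ := QuotientGroup.mk_out_eq_mul A g
    refine Set.mem_iUnion.2 ⟨(g : G ⧸ A), f (a : G)⁻¹, hle ⟨_, A.inv_mem a.2, rfl⟩, ?_⟩
    change f _ * f _ = f g
    rw [ha, ← map_mul, mul_inv_cancel_right]
  have : Finite (P ⧸ B) := by
    refine Finite.of_surjective (fun q : G ⧸ A ↦ (QuotientGroup.mk (f q.out) : P ⧸ B)) ?_
    rintro ⟨p⟩
    obtain ⟨q, b, hb, rfl⟩ := Set.mem_iUnion.1 (hcover.symm ▸ Set.mem_univ p)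
    exact ⟨q, QuotientGroup.eq.2 (by simpa using hb)⟩
  have : B.FiniteIndex := Subgroup.finiteIndex_of_finite_quotient
  have hmap : ∀ x y : A.map f, x * y = y * x := by
    rintro ⟨_, x, hx, rfl⟩ ⟨_, y, hy, rfl⟩
    refine Subtype.ext ?_
    change f x * f y = f y * f x
    rw [← map_mul, hcomm x hx y hy, map_mul]
  refine .of_finiteIndex B fun x hx y hy ↦ ?_
  let _ := (A.map f).commGroupTopologicalClosure hmap
  exact congrArg Subtype.val (mul_comm (⟨x, hx⟩ : B) ⟨y, hy⟩)

end AbelianByFinite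

/-! ### Profinite groups with many commuting pairs. -/

section Profinite

variable (P : Type*) [Group P] [TopologicalSpace P] [IsTopologicalGroup P] [CompactSpace P]
  [TotallyDisconnectedSpace P]

theorem isResidualFamily_isOpen :
    IsResidualFamily {U : FiniteIndexNormalSubgroup P | IsOpen (U : Set P)} where
  nonempty := ⟨FiniteIndexNormalSubgroup.ofSubgroup ⊤, isOpen_univ⟩
  inf_mem _ hU _ hV := hU.inter hV
  separates g hg := by
    obtain ⟨U, hU⟩ := ProfiniteGrp.exist_openNormalSubgroup_sub_open_nhds_of_one
      (isOpen_compl_singleton (x := g)) (Ne.symm hg)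
    exact ⟨U.toFiniteIndexNormalSubgroup, U.isOpen', fun h ↦ hU h rfl⟩

theorem residuallyFinite_of_profinite : Group.ResiduallyFinite P :=
  Group.residuallyFinite_iff_exists_finiteIndexNormalSubgroup.2 fun g hg ↦
    ((isResidualFamily_isOpen P).separates g hg).imp fun _ h ↦ h.2

variable {P}

/-- If at least one in `d` pairs commute in each quotient of a profinite group by an open normal
subgroup, then the group has an open normal subgroup of class at most two whose index and derived
subgroup are bounded in terms of `d`. -/
theorem exists_isOpen_nilpotencyClass_le_two {d n b : ℕ} (hd : 0 < d)
    (hn : n = (2 * d) ^ (3 * (2 * d) + 1)) (hb : b = derivedBound (n ^ (n + 3)))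
    (h : ∀ U : FiniteIndexNormalSubgroup P, IsOpen (U : Set P) →
      Nat.card (P ⧸ U.toSubgroup) ^ 2 ≤
        d * Nat.card {p : (P ⧸ U.toSubgroup) × (P ⧸ U.toSubgroup) // p.1 * p.2 = p.2 * p.1}) :
    ∃ N : Subgroup P, IsOpen (N : Set P) ∧ N.Normal ∧ Group.IsNilpotent N ∧
      Group.nilpotencyClass N ≤ 2 ∧ Finite (⁅N, N⁆ : Subgroup P) ∧
      Nat.card (⁅N, N⁆ : Subgroup P) ≤ b ∧ N.FiniteIndex ∧ N.index ≤ 2 * d * n ^ b := by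
  obtain ⟨H, hHn, hHf, hHi, ⟨U, hU, hUH⟩, hcl⟩ :=
    (isResidualFamily_isOpen P).exists_bounded_classes hd h
  rw [← hn] at hcl
  obtain ⟨hKf, hKc⟩ := card_commutator_le H hcl
  rw [← hb] at hKc
  set K : Subgroup P := ⁅H, H⁆ with hK
  have hKH : K ≤ H := Subgroup.commutator_le_left H H
  have hnpos : 0 < n := by rw [hn]; positivity
  obtain ⟨hCf, hCi⟩ := index_centralizer_le hnpos (K : Set P)
    (Set.encard_le_coe_iff_finite_ncard_le.2 ⟨Set.toFinite _, hKc⟩) fun y hy ↦ hcl y (hKH hy)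
  -- `[N, N] ≤ K` and `N` centralizes `K`, hence class at most two. The centralizer has index at
  -- most `n ^ b`, as `K` has at most `b` elements with at most `n` conjugates each.
  set N := H ⊓ Subgroup.centralizer (K : Set P) with hN
  have hNK : (⁅N, N⁆ : Subgroup P) ≤ K := Subgroup.commutator_mono inf_le_left inf_le_left
  have hHo : IsOpen (H : Set P) := Subgroup.isOpen_mono hUH hU
  have hCo : IsOpen (Subgroup.centralizer (K : Set P) : Set P) :=
    Subgroup.isOpen_of_isClosed_of_finiteIndex _ (Set.isClosed_centralizer _)
  have hlcs : N.lowerCentralSeries 2 = ⊥ := by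
    change (⁅⁅N, N⁆, N⁆ : Subgroup P) = ⊥
    rw [Subgroup.commutator_eq_bot_iff_le_centralizer]
    exact hNK.trans ((Subgroup.le_centralizer_iff).1 inf_le_right)
  have hnil : Group.IsNilpotent N := (Subgroup.isNilpotent_iff_lowerCentralSeries N).2 ⟨2, hlcs⟩
  have hKN : Nat.card (⁅N, N⁆ : Subgroup P) ≤ Nat.card K :=
    Nat.card_le_card_of_injective _ (Subgroup.inclusion_injective hNK)
  refine ⟨N, hHo.inter hCo, inferInstance, hnil, ?_,
    Finite.of_injective _ (Subgroup.inclusion_injective hNK), hKN.trans hKc, inferInstance,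
    Subgroup.index_inf_le.trans (Nat.mul_le_mul hHi hCi)⟩
  rw [← Subgroup.lowerCentralSeries_eq_bot_iff_nilpotencyClass_le, ← Subgroup.map_subtype_inj,
    Subgroup.map_bot, Subgroup.top_subtype_lowerCentralSeries, hlcs]

end Profinite

/-! ### Applying `rhoCom` to finite quotients. -/

section CommutingPairsCount

variable {G : Type*} [Group G]

theorem card_commuting_congr {A B : Type*} [Group A] [Group B] (e : A ≃* B) :
    Nat.card {p : A × A // p.1 * p.2 = p.2 * p.1} =
      Nat.card {p : B × B // p.1 * p.2 = p.2 * p.1} := by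
  refine Nat.card_congr ((Equiv.prodCongr e.toEquiv e.toEquiv).subtypeEquiv fun p ↦ ?_)
  change _ ↔ e p.1 * e p.2 = e p.2 * e p.1
  rw [← map_mul, ← map_mul, e.injective.eq_iff]

/-- The orbit of `M` consists of its cosets, and `g` fixes `h • M` exactly when `h⁻¹ * g * h ∈ M`.
Thus `G ⧸ M` is itself a group `G(Y)`. -/
theorem pointwiseStabilizer_singleton_normal (M : Subgroup G) [M.Normal] :
    pointwiseStabilizer {(M : Set G)} = M := by
  ext g
  simp only [pointwiseStabilizer, mem_fixingSubgroup_iff, orbitUnion, Finset.mem_singleton,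
    Set.iUnion_iUnion_eq_left, MulAction.mem_orbit_iff, forall_exists_index,
    forall_apply_eq_imp_iff]
  have key (h : G) : g • h • (M : Set G) = h • (M : Set G) ↔ g ∈ M := by
    rw [smul_smul, eq_comm, leftCoset_eq_iff, ← mul_assoc,
      ← Subgroup.Normal.mem_comm_iff ‹M.Normal›, mul_inv_cancel_left]
  simp [key]

/-- Take `Y` to be the cosets of `M` and `L` the whole of `G(Y)` in the infimum. -/
theorem rhoCom_le_card_commuting (M : FiniteIndexNormalSubgroup G) :
    rhoCom (⊤ : Subgroup G) (Nat.card (G ⧸ M.toSubgroup)) ≤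
      (Nat.card {p : (G ⧸ M.toSubgroup) × (G ⧸ M.toSubgroup) // p.1 * p.2 = p.2 * p.1} : ℕ∞) := by
  let e : G ⧸ pointwiseStabilizer {(M.toSubgroup : Set G)} ≃* G ⧸ M.toSubgroup :=
    QuotientGroup.quotientMulEquivOfEq (pointwiseStabilizer_singleton_normal M.toSubgroup)
  have : Finite (G ⧸ pointwiseStabilizer {(M.toSubgroup : Set G)}) :=
    Finite.of_equiv _ e.symm.toEquiv
  have hF : (({(M.toSubgroup : Set G)} : Finset (Set G)) : Set (Set G)) ⊆ cosetFamily ⊤ := by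
    simp only [Finset.coe_singleton, Set.singleton_subset_iff]
    refine ⟨1, M.toSubgroup, ⟨?_, ?_⟩, (one_smul _ _).symm⟩
    · rw [Subgroup.relIndex_top_right]
      exact Subgroup.FiniteIndex.index_ne_zero
    · rw [Subgroup.relIndex_top_left]
      exact one_ne_zero
  have hcard : Nat.card (⊤ : Subgroup (G ⧸ pointwiseStabilizer {(M.toSubgroup : Set G)})) =
      Nat.card (G ⧸ M.toSubgroup) :=
    Nat.card_congr (Subgroup.topEquiv.trans e).toEquiv
  rw [← card_commuting_congr (Subgroup.topEquiv.trans e)]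
  exact iInf_le_of_le _ (iInf_le_of_le hF (iInf_le_of_le ⊤ (iInf_le_of_le inferInstance
    (iInf_le_of_le hcard le_rfl))))

theorem sq_card_le_of_rhoCom {ε : ℝ} (hε : 0 < ε) (M : FiniteIndexNormalSubgroup G)
    (h : ENNReal.ofReal ε * (Nat.card (G ⧸ M.toSubgroup) : ℝ≥0∞) ^ 2 ≤
      (rhoCom (⊤ : Subgroup G) (Nat.card (G ⧸ M.toSubgroup)) : ℝ≥0∞)) :
    Nat.card (G ⧸ M.toSubgroup) ^ 2 ≤ ⌈ε⁻¹⌉₊ *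
      Nat.card {p : (G ⧸ M.toSubgroup) × (G ⧸ M.toSubgroup) // p.1 * p.2 = p.2 * p.1} := by
  set q := Nat.card (G ⧸ M.toSubgroup)
  set m := Nat.card {p : (G ⧸ M.toSubgroup) × (G ⧸ M.toSubgroup) // p.1 * p.2 = p.2 * p.1}
  have h1 : ENNReal.ofReal ε * (q : ℝ≥0∞) ^ 2 ≤ (m : ℝ≥0∞) := by
    refine h.trans ?_
    have := ENat.toENNReal_le.2 (rhoCom_le_card_commuting M)
    simpa using this
  have h2 : ε * (q : ℝ) ^ 2 ≤ m := by
    have h3 : ENNReal.ofReal (ε * (q : ℝ) ^ 2) ≤ ENNReal.ofReal m := by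
      rw [ENNReal.ofReal_mul hε.le, ENNReal.ofReal_pow (Nat.cast_nonneg _),
        ENNReal.ofReal_natCast, ENNReal.ofReal_natCast]
      exact h1
    exact (ENNReal.ofReal_le_ofReal_iff (Nat.cast_nonneg _)).1 h3
  have h4 : ((q : ℝ)) ^ 2 ≤ ε⁻¹ * m := by
    rw [inv_mul_eq_div, le_div_iff₀ hε, mul_comm]
    exact h2
  exact_mod_cast h4.trans (mul_le_mul_of_nonneg_right (Nat.le_ceil _) (Nat.cast_nonneg _))

end CommutingPairsCount

/-! ### The profinite completion and its finite quotients. -/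

section Completion

variable (G : Type*) [Group G]

/-- The canonical homomorphism from a group to its profinite completion. -/
noncomputable def toCompletion : G →* Completion G :=
  (ProfiniteGrp.ProfiniteCompletion.eta (GrpCat.of G)).hom

theorem denseRange_toCompletion : DenseRange (toCompletion G) :=
  ProfiniteGrp.ProfiniteCompletion.denseRange (GrpCat.of G)

theorem toCompletion_injective [h : Group.ResiduallyFinite G] :
    Function.Injective (toCompletion G) :=
  (ProfiniteGrp.ProfiniteCompletion.etaFn_injective_iff_residuallyFinite (GrpCat.of G)).2 h

variable {G}

/-- The quotients of the profinite completion by open normal subgroups are quotients of `G`. -/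
theorem exists_quotient_mulEquiv (U : FiniteIndexNormalSubgroup (Completion G))
    (hU : IsOpen (U : Set (Completion G))) :
    ∃ M : FiniteIndexNormalSubgroup G,
      Nonempty (G ⧸ M.toSubgroup ≃* Completion G ⧸ U.toSubgroup) := by
  let φ := (QuotientGroup.mk' U.toSubgroup).comp (toCompletion G)
  -- Each coset of `U` is open and nonempty, so it meets the dense image of `G`.
  have hφ : Function.Surjective φ := by
    rintro ⟨x⟩
    obtain ⟨_, ⟨u, hu, hux⟩, g, rfl⟩ := (denseRange_toCompletion G).inter_open_nonempty
      (x • (U : Set (Completion G))) (hU.smul x) ⟨x, 1, one_mem U, by simp⟩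
    refine ⟨g, ?_⟩
    refine (QuotientGroup.eq.2 ?_).symm
    rw [← hux]
    simpa using! hu
  have hker : φ.ker = (U.comap (toCompletion G)).toSubgroup := by
    ext g
    exact QuotientGroup.eq_one_iff _
  exact ⟨U.comap (toCompletion G), ⟨(QuotientGroup.quotientMulEquivOfEq hker.symm).trans
    (QuotientGroup.quotientKerEquivOfSurjective φ hφ)⟩⟩

end Completion

end CommutingPairs
-- The main theorem.
open CommutingPairs in
theorem mainTheorem7 :
    (∀ ε : ℝ, 0 < ε → ε < 1 → ∃ b : ℕ,
      ∀ (G : Type*) [Group G] [Group.ResiduallyFinite G],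
        (∀ M : FiniteIndexNormalSubgroup G,
          ENNReal.ofReal ε * (Nat.card (G ⧸ M.toSubgroup) : ℝ≥0∞) ^ 2 ≤
            (rhoCom (⊤ : Subgroup G) (Nat.card (G ⧸ M.toSubgroup)) : ℝ≥0∞)) →
        IsAbelianByFinite G ∧ IsAbelianByFinite (Completion G) ∧
        ∃ N : Subgroup (Completion G),
          IsOpen (N : Set (Completion G)) ∧ N.Normal ∧
          Group.IsNilpotent N ∧ Group.nilpotencyClass N ≤ 2 ∧
          Finite (⁅N, N⁆ : Subgroup (Completion G)) ∧
          Nat.card (⁅N, N⁆ : Subgroup (Completion G)) ≤ b ∧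
          N.FiniteIndex ∧ N.index ≤ b) ∧
    (∀ (G : Type*) [Group G] [Group.ResiduallyFinite G],
      IsFiniteByAbelianByFinite G →
        IsAbelianByFinite G ∧ IsAbelianByFinite (Completion G)) := by
  refine ⟨fun ε hε _ ↦ ?_, fun G _ _ h ↦
    ⟨h.isAbelianByFinite, h.isAbelianByFinite.of_denseRange (denseRange_toCompletion G)⟩⟩
  have hd : 0 < ⌈ε⁻¹⌉₊ := Nat.ceil_pos.2 (inv_pos.2 hε)
  set d := ⌈ε⁻¹⌉₊ with hd_def
  obtain ⟨n, hn⟩ : ∃ n, n = (2 * d) ^ (3 * (2 * d) + 1) := ⟨_, rfl⟩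
  obtain ⟨b, hb⟩ : ∃ b, b = derivedBound (n ^ (n + 3)) := ⟨_, rfl⟩
  refine ⟨max b (2 * d * n ^ b), fun G _ _ h ↦ ?_⟩
  obtain ⟨N, hNo, hNn, hnil, hcl, hf, hcard, hfi, hi⟩ :=
    exists_isOpen_nilpotencyClass_le_two (P := Completion G) hd hn hb fun U hU ↦ by
      obtain ⟨M, ⟨e⟩⟩ := exists_quotient_mulEquiv U hU
      rw [← Nat.card_congr e.toEquiv, ← card_commuting_congr e]
      exact sq_card_le_of_rhoCom hε M (h M)
  have := residuallyFinite_of_profinite (Completion G)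
  -- The completion is residually finite and `[N, N]` is finite, so the second part's criterion
  -- applies; `G` inherits the property through its embedding.
  have habf : IsAbelianByFinite (Completion G) :=
    IsFiniteByAbelianByFinite.isAbelianByFinite
      ⟨⁅N, N⁆, N, inferInstance, hNn, Subgroup.commutator_le_left N N, hf, hfi, le_rfl⟩
  exact ⟨habf.of_injective (toCompletion_injective G), habf, N, hNo, hNn, hnil, hcl, hf,
    hcard.trans (le_max_left _ _), hfi, hi.trans (le_max_right _ _)⟩
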